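/- Let $\Omega\subset\mathbb{R}^d$ be a bounded open set (in the applications, with Lipschitz boundary) and let $m_1,\dots,m_n\in\Omega$ be fixed. For $\sigma>0$ let $\phi_i^\sigma$ be the Gaussian density on $\mathbb{R}^d$ with mean $m_i$ and covariance $\sigma^2 I$, $$\phi_i^\sigma(x)=(2\pi\sigma^2)^{-d/2}\exp\Big(-\tfrac{|x-m_i|^2}{2\sigma^2}\Big),$$ and put $V_\sigma=\mathrm{span}\{\phi_1^\sigma,\dots,\phi_n^\sigma\}$. Let $E$ be a bounded extension operator $H^1(\Omega)\to H^1(\mathbb{R}^d)$, that is, $Ef=f$ almost everywhere on $\Omega$ and $\|Ef\|_{H^1(\mathbb{R}^d)}\le K\|f\|_{H^1(\Omega)}$ for all $f\in H^1(\Omega)$, with $K$ independent of $f$. With $\Omega^c=\mathbb{R}^d\setminus\Omega$ set $$B^c(w,v)=\int_{\Omega^c}\nabla w\cdot\nabla v,\qquad F^c(v)=\int_{\Omega^c}(Ef)\,v .$$ For $u\in H^1(\Omega)$ and mappings $\pi_\sigma$ from $H^1(\Omega)$ to $V_\sigma$ ($\sigma>0$) define the consistency error on the complement $$\varepsilon_{con}(\Omega^c)=\sup_{v\in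 V_\sigma,\ v\ne0}\frac{|B^c(\pi_\sigma u,v)-F^c(v)|}{\|v\|_{H^1(\mathbb{R}^d)}}$$ (with the value $0$ if $n=0$). Then there is a constant $c>0$, depending only on $\Omega$ and $m_1,\dots,m_n$, such that the following holds for every such $E$, every $f,u\in H^1(\Omega)$ and every such family $(\pi_\sigma)$ for which either (i) $u$ is continuous on $\Omega$ and $\pi_\sigma u$ interpolates $u$ at the means, $\pi_\sigma u(m_i)=u(m_i)$ for all $i$ and all $\sigma>0$, or (ii) $\|\pi_\sigma u\|_{H^1(\mathbb{R}^d)}=\mathcal{O}(\sigma^{-q})$ as $\sigma\to0^+$ for some $q\in\mathbb{N}$. The supremum is finite for every $\sigma>0$, and $$\varepsilon_{con}(\Omega^c)=\mathcal{O}\Big(\sigma^{-(d+4)}\exp\Big(-\frac{c}{2\sigma^2}\Big)\Big)\qquad(\sigma\to0^+).$$ In particular it decays exponentially: $\varepsilon_{con}(\Omega^c)=\mathcal{O}(\exp(-c'/\sigma^2))$ as $\sigma\to0^+$ for every $c'<c/2$. -/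

import Mathlib

open MeasureTheory Filter Topology Set
open scoped ContDiff Matrix

noncomputable section

/-- The Gaussian density on `ℝ^d` with mean `m` and covariance matrix `C`. -/
def gaussianRBF {d : ℕ} (m : EuclideanSpace ℝ (Fin d)) (C : Matrix (Fin d) (Fin d) ℝ)
    (x : EuclideanSpace ℝ (Fin d)) : ℝ :=
  (2 * Real.pi) ^ (-(d : ℝ) / 2) * C.det ^ (-(1 : ℝ) / 2) *
    Real.exp (-(1 / 2) * ((x - m).ofLp ⬝ᵥ (C⁻¹ *ᵥ (x - m).ofLp)))

/-- `V_h`: the span of the isotropic Gaussians with means `m i` and covariances `σ² I`. -/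
def grbfSpace {d n : ℕ} (m : Fin n → EuclideanSpace ℝ (Fin d)) (σ : ℝ) :
    Submodule ℝ (EuclideanSpace ℝ (Fin d) → ℝ) :=
  Submodule.span ℝ
    (range fun i => gaussianRBF (m i) ((σ ^ 2) • (1 : Matrix (Fin d) (Fin d) ℝ)))

/-- `g` is a weak gradient of `u` on `Ω`, both square integrable on `Ω`. -/
def IsL2WeakGradient {d : ℕ} (Ω : Set (EuclideanSpace ℝ (Fin d)))
    (u : EuclideanSpace ℝ (Fin d) → ℝ)
    (g : EuclideanSpace ℝ (Fin d) → EuclideanSpace ℝ (Fin d)) : Prop :=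
  MemLp u 2 (volume.restrict Ω) ∧ MemLp g 2 (volume.restrict Ω) ∧
    ∀ ψ : EuclideanSpace ℝ (Fin d) → ℝ, ContDiff ℝ ∞ ψ → HasCompactSupport ψ → tsupport ψ ⊆ Ω →
      ∫ x in Ω, u x • gradient ψ x = -∫ x in Ω, ψ x • g x

/-- `u` (a representative of a class) belongs to the Sobolev space `H¹(Ω) = W^1_2(Ω)`. -/
def MemH1 {d : ℕ} (Ω : Set (EuclideanSpace ℝ (Fin d)))
    (u : EuclideanSpace ℝ (Fin d) → ℝ) : Prop :=
  ∃ g, IsL2WeakGradient Ω u g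

open Classical in
/-- The weak gradient on `Ω` of an element of `H¹(Ω)` (unique almost everywhere on an open `Ω`;
zero by convention outside `H¹(Ω)`). -/
def weakGradient {d : ℕ} (Ω : Set (EuclideanSpace ℝ (Fin d)))
    (u : EuclideanSpace ℝ (Fin d) → ℝ) : EuclideanSpace ℝ (Fin d) → EuclideanSpace ℝ (Fin d) :=
  if h : MemH1 Ω u then h.choose else 0

/-- The norm of `H¹(Ω)`. -/
def h1Norm {d : ℕ} (Ω : Set (EuclideanSpace ℝ (Fin d)))
    (u : EuclideanSpace ℝ (Fin d) → ℝ) : ℝ :=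
  Real.sqrt ((∫ x in Ω, u x ^ 2) + ∫ x in Ω, ‖weakGradient Ω u x‖ ^ 2)

/-- `E` is a bounded extension operator from `H¹(Ω)` to `H¹(ℝ^d)`. -/
structure IsExtensionOperator {d : ℕ} (Ω : Set (EuclideanSpace ℝ (Fin d)))
    (E : (EuclideanSpace ℝ (Fin d) → ℝ) → EuclideanSpace ℝ (Fin d) → ℝ) : Prop where
  memH1 : ∀ f, MemH1 Ω f → MemH1 univ (E f)
  restrict_eq : ∀ f, MemH1 Ω f → E f =ᵐ[volume.restrict Ω] f
  bounded : ∃ K : ℝ, ∀ f, MemH1 Ω f → h1Norm univ (E f) ≤ K * h1Norm Ω f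

/-- `B^c(u, v) = ∫_{Ω^c} ∇u · ∇v`. -/
def complementForm {d : ℕ} (Ω : Set (EuclideanSpace ℝ (Fin d)))
    (u v : EuclideanSpace ℝ (Fin d) → ℝ) : ℝ :=
  ∫ x in Ωᶜ, inner ℝ (gradient u x) (gradient v x)

/-- `F^c(v) = ∫_{Ω^c} (E f) v`. -/
def complementLoad {d : ℕ} (Ω : Set (EuclideanSpace ℝ (Fin d)))
    (E : (EuclideanSpace ℝ (Fin d) → ℝ) → EuclideanSpace ℝ (Fin d) → ℝ)
    (f v : EuclideanSpace ℝ (Fin d) → ℝ) : ℝ :=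
  ∫ x in Ωᶜ, E f x * v x

/-- The quotient `|B^c(uh, v) - F^c(v)| / ‖v‖`, with the norm of `H¹(ℝ^d)` (zero for `v = 0`). -/
def consistencyQuotient {d : ℕ} (Ω : Set (EuclideanSpace ℝ (Fin d)))
    (E : (EuclideanSpace ℝ (Fin d) → ℝ) → EuclideanSpace ℝ (Fin d) → ℝ)
    (f uh v : EuclideanSpace ℝ (Fin d) → ℝ) : ℝ :=
  |complementForm Ω uh v - complementLoad Ω E f v| / h1Norm univ v

/-- The consistency error on the complement: the supremum of the quotient over `v ∈ V_h`. -/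
def consistencyError {d n : ℕ} (Ω : Set (EuclideanSpace ℝ (Fin d)))
    (m : Fin n → EuclideanSpace ℝ (Fin d)) (σ : ℝ)
    (E : (EuclideanSpace ℝ (Fin d) → ℝ) → EuclideanSpace ℝ (Fin d) → ℝ)
    (f uh : EuclideanSpace ℝ (Fin d) → ℝ) : ℝ :=
  ⨆ v : grbfSpace m σ, consistencyQuotient Ω E f uh v

end

/-! Put b = 1/(2σ²). Each mean has a ball of radius δ inside Ω, so outside Ω every Gaussian, and
also its gradient up to a factor b + 1, is at most exp(-bδ²/4) times an integrable wider Gaussian.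
Both complement terms are therefore exponentially small relative to the ℓ¹ norms of the coefficients
of `v` and of the representative of `u` (`abs_complementForm_bumpSum_le`,
`abs_complementLoad_bumpSum_le`).

It remains to see that these coefficients cost only powers of b. For distinct centres the normalised
Gram matrix has entries exp(-b|pᵢ - pⱼ|²/2) and tends to the identity, so the coefficients are
bounded by a power of b times the L² norm (`sum_abs_le_pow_mul_sqrt_integral`). This treats `v`, and
`u` in case (ii); in case (i) the interpolation matrix is nearly diagonal in the same way
(`sum_abs_le_sum_abs_bumpSum`). Half of the exponent absorbs every power of b, which leaves c =
δ²/8. For a fixed σ, where near-diagonality may fail, finite dimensionality gives the finite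
supremum (`exists_bumpSum_sum_abs_le`). -/

noncomputable section

/-- The unnormalised isotropic Gaussian `exp (-b ‖x - p‖²)`. -/
def bump {d : ℕ} (b : ℝ) (p x : EuclideanSpace ℝ (Fin d)) : ℝ :=
  Real.exp (-b * ‖x - p‖ ^ 2)

/-- The combination of isotropic Gaussians with coefficients `a` and centres `p`. -/
def bumpSum {d : ℕ} {ι : Type*} [Fintype ι] (b : ℝ) (p : ι → EuclideanSpace ℝ (Fin d))
    (a : ι → ℝ) (x : EuclideanSpace ℝ (Fin d)) : ℝ :=
  ∑ i, a i * bump b (p i) x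

/-! ### Single Gaussians: products, integrals, gradients, decay -/

section Bump

variable {d : ℕ} {b : ℝ} {p q x : EuclideanSpace ℝ (Fin d)}

lemma bump_pos : 0 < bump b p x := Real.exp_pos _

lemma bump_le_one (hb : 0 ≤ b) : bump b p x ≤ 1 := by
  rw [bump, Real.exp_le_one_iff]
  nlinarith [sq_nonneg ‖x - p‖]

lemma bump_self : bump b p p = 1 := by simp [bump]

lemma continuous_bump (b : ℝ) (p : EuclideanSpace ℝ (Fin d)) : Continuous (bump b p) := by
  unfold bump
  fun_prop

lemma bump_mul_same {b c : ℝ} : bump b p x * bump c p x = bump (b + c) p x := by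
  rw [bump, bump, bump, ← Real.exp_add]
  ring_nf

/-- By the parallelogram law the product is a Gaussian about the midpoint; this makes the Gram
matrix explicit. -/
lemma bump_mul_bump :
    bump b p x * bump b q x =
      Real.exp (-(b / 2) * ‖p - q‖ ^ 2) * bump (2 * b) ((1 / 2 : ℝ) • (p + q)) x := by
  rw [bump, bump, bump, ← Real.exp_add, ← Real.exp_add]
  congr 1
  have h := parallelogram_law_with_norm ℝ (x - p) (x - q)
  have h1 : x - p + (x - q) = (2 : ℝ) • (x - (1 / 2 : ℝ) • (p + q)) := by
    rw [smul_sub, smul_smul, two_smul]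
    norm_num
    abel
  have h2 : x - p - (x - q) = -(p - q) := by abel
  rw [h1, h2, norm_neg, norm_smul, Real.norm_two] at h
  linear_combination (b / 2) * h

lemma integrable_bump (hb : 0 < b) (p : EuclideanSpace ℝ (Fin d)) : Integrable (bump b p) := by
  have h := GaussianFourier.integrable_cexp_neg_mul_sq_norm_add (V := EuclideanSpace ℝ (Fin d))
    (b := (b : ℂ)) (by simpa using hb) 0 0
  have h2 : Integrable (fun x : EuclideanSpace ℝ (Fin d) => Real.exp (-b * ‖x‖ ^ 2)) := by
    refine h.re.congr (ae_of_all _ fun x => ?_)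
    simp only [zero_mul, add_zero]
    norm_cast
  exact h2.comp_sub_right p

lemma integral_bump (hb : 0 < b) (p : EuclideanSpace ℝ (Fin d)) :
    ∫ x, bump b p x = (Real.pi / b) ^ ((d : ℝ) / 2) := by
  have h := GaussianFourier.integral_rexp_neg_mul_sq_norm (V := EuclideanSpace ℝ (Fin d)) hb
  rw [finrank_euclideanSpace_fin] at h
  rw [← h]
  exact integral_sub_right_eq_self (fun x => Real.exp (-b * ‖x‖ ^ 2)) p

lemma hasGradientAt_bump (b : ℝ) (p x : EuclideanSpace ℝ (Fin d)) :
    HasGradientAt (bump b p) ((-2 * b * bump b p x) • (x - p)) x := by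
  rw [hasGradientAt_iff_hasFDerivAt]
  have h : HasFDerivAt (fun y : EuclideanSpace ℝ (Fin d) => ‖y - p‖ ^ 2)
      (2 • (innerSL ℝ (x - p)).comp (ContinuousLinearMap.id ℝ _)) x :=
    ((hasFDerivAt_id x).sub_const p).norm_sq
  refine ((h.const_mul (-b)).exp).congr_fderiv ?_
  ext y
  simp [bump]
  ring

/-- Half of the Gaussian is spent on the linear factor ‖x - p‖, the other half is kept. -/
lemma norm_gradient_bump_le (hb : 0 ≤ b) :
    ‖(-2 * b * bump b p x) • (x - p)‖ ≤ (b + 1) * bump (b / 2) p x := by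
  set r := ‖x - p‖ with hr
  have h1 : bump b p x = bump (b / 2) p x * bump (b / 2) p x := by
    rw [bump_mul_same]; congr 1; ring
  have hp : 0 < bump (b / 2) p x := bump_pos
  rw [norm_smul, norm_mul, norm_mul, Real.norm_of_nonneg bump_pos.le, Real.norm_of_nonneg hb,
    ← hr, h1]
  norm_num
  -- With t = b r² this is t ≤ exp(t/2), which follows from t ≤ 1 + t/2 + t²/8.
  have h2 : b * r ^ 2 * bump (b / 2) p x ≤ 1 := by
    have h3 := Real.quadratic_le_exp_of_nonneg (x := b / 2 * r ^ 2) (by positivity)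
    have h4 : bump (b / 2) p x = (Real.exp (b / 2 * r ^ 2))⁻¹ := by
      rw [bump, ← Real.exp_neg, hr]; ring_nf
    rw [h4, ← div_eq_mul_inv, div_le_one (Real.exp_pos _)]
    nlinarith [sq_nonneg (b * r ^ 2 - 2)]
  have h5 : 2 * b * r ≤ b + b * r ^ 2 := by nlinarith [mul_nonneg hb (sq_nonneg (r - 1))]
  have h6 : bump (b / 2) p x ≤ 1 := bump_le_one (by positivity)
  have h7 : 2 * b * r * bump (b / 2) p x ≤ b + 1 := by
    calc _ ≤ (b + b * r ^ 2) * bump (b / 2) p x := by gcongr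
      _ = b * bump (b / 2) p x + b * r ^ 2 * bump (b / 2) p x := by ring
      _ ≤ b * 1 + 1 := by gcongr
      _ = _ := by ring
  calc _ = 2 * b * r * bump (b / 2) p x * bump (b / 2) p x := by ring
    _ ≤ _ := by gcongr

/-- Of two equal factors, one is bounded by its value at distance δ and the other remains for
integrability. -/
lemma bump_le_of_le_dist {δ : ℝ} (hb : 0 ≤ b) (hδ : 0 ≤ δ) (h : δ ≤ ‖x - p‖) :
    bump (2 * b) p x ≤ Real.exp (-b * δ ^ 2) * bump b p x := by
  have h1 : bump (2 * b) p x = bump b p x * bump b p x := by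
    rw [bump_mul_same]; congr 1; ring
  rw [h1]
  have h2 : bump b p x ≤ Real.exp (-b * δ ^ 2) := by
    rw [bump, Real.exp_le_exp]
    have := pow_le_pow_left₀ hδ h 2
    nlinarith
  exact mul_le_mul_of_nonneg_right h2 bump_pos.le

end Bump

/-! ### Linear combinations of Gaussians and their L² norm -/

section BumpSum

variable {d : ℕ} {ι : Type*} [Fintype ι] {b : ℝ} {p : ι → EuclideanSpace ℝ (Fin d)}
  {a : ι → ℝ} {x : EuclideanSpace ℝ (Fin d)}

lemma continuous_bumpSum (b : ℝ) (p : ι → EuclideanSpace ℝ (Fin d)) (a : ι → ℝ) :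
    Continuous (bumpSum b p a) := by
  unfold bumpSum
  exact continuous_finsetSum _ fun i _ => (continuous_bump b (p i)).const_mul (a i)

lemma gradient_bumpSum (b : ℝ) (p : ι → EuclideanSpace ℝ (Fin d)) (a : ι → ℝ)
    (x : EuclideanSpace ℝ (Fin d)) :
    gradient (bumpSum b p a) x = ∑ i, a i • ((-2 * b * bump b (p i) x) • (x - p i)) := by
  refine HasGradientAt.gradient ?_
  rw [hasGradientAt_iff_hasFDerivAt, map_sum]
  refine (HasFDerivAt.fun_sum fun i _ =>
    ((hasGradientAt_bump b (p i) x).hasFDerivAt.const_mul (a i))).congr_fderiv ?_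
  simp

lemma norm_gradient_bumpSum_le (hb : 0 ≤ b) :
    ‖gradient (bumpSum b p a) x‖ ≤ ∑ i, |a i| * ((b + 1) * bump (b / 2) (p i) x) := by
  rw [gradient_bumpSum]
  refine (norm_sum_le _ _).trans (Finset.sum_le_sum fun i _ => ?_)
  rw [norm_smul, Real.norm_eq_abs]
  exact mul_le_mul_of_nonneg_left (norm_gradient_bump_le hb) (abs_nonneg _)

lemma abs_bumpSum_le : |bumpSum b p a x| ≤ ∑ i, |a i| * bump b (p i) x := by
  refine (Finset.abs_sum_le_sum_abs _ _).trans (Finset.sum_le_sum fun i _ => ?_)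
  rw [abs_mul, abs_of_pos bump_pos]

lemma memLp_bump (hb : 0 < b) (p : EuclideanSpace ℝ (Fin d)) : MemLp (bump b p) 2 := by
  rw [memLp_two_iff_integrable_sq (continuous_bump b p).aestronglyMeasurable]
  simp_rw [sq, bump_mul_same]
  exact integrable_bump (by positivity) p

lemma memLp_bumpSum (hb : 0 < b) (p : ι → EuclideanSpace ℝ (Fin d)) (a : ι → ℝ) :
    MemLp (bumpSum b p a) 2 :=
  memLp_finsetSum _ fun i _ => (memLp_bump hb (p i)).const_mul (a i)

lemma integral_bumpSum_sq (hb : 0 < b) (p : ι → EuclideanSpace ℝ (Fin d)) (a : ι → ℝ) :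
    ∫ x, bumpSum b p a x ^ 2 = (Real.pi / (2 * b)) ^ ((d : ℝ) / 2) *
      ∑ i, ∑ j, a i * a j * Real.exp (-(b / 2) * ‖p i - p j‖ ^ 2) := by
  have h : ∀ x, bumpSum b p a x ^ 2 = ∑ i, ∑ j, a i * a j *
      Real.exp (-(b / 2) * ‖p i - p j‖ ^ 2) * bump (2 * b) ((1 / 2 : ℝ) • (p i + p j)) x := by
    intro x
    rw [sq, bumpSum, Finset.sum_mul_sum]
    refine Finset.sum_congr rfl fun i _ => Finset.sum_congr rfl fun j _ => ?_
    rw [mul_assoc (a i * a j), ← bump_mul_bump]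
    ring
  have hi : ∀ i j, Integrable fun x => a i * a j * Real.exp (-(b / 2) * ‖p i - p j‖ ^ 2) *
      bump (2 * b) ((1 / 2 : ℝ) • (p i + p j)) x :=
    fun i j => (integrable_bump (by positivity) _).const_mul _
  simp_rw [h]
  rw [integral_finsetSum _ fun i _ => integrable_finsetSum _ fun j _ => hi i j, Finset.mul_sum]
  refine Finset.sum_congr rfl fun i _ => ?_
  rw [integral_finsetSum _ fun j _ => hi i j, Finset.mul_sum]
  refine Finset.sum_congr rfl fun j _ => ?_
  rw [integral_const_mul, integral_bump (by positivity)]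
  ring

end BumpSum

/-! ### Coefficient bounds for separated centres -/

/-- Near-diagonal dominance of a matrix with unit diagonal and off-diagonal entries in `[0, η]`. -/
lemma sum_sq_sub_le_sum_mul {ι : Type*} [Fintype ι] (a : ι → ℝ) (e : ι → ι → ℝ) {η : ℝ}
    (h1 : ∀ i, e i i = 1) (h0 : ∀ i j, 0 ≤ e i j) (hη : ∀ i j, i ≠ j → e i j ≤ η)
    (hη0 : 0 ≤ η) :
    ∑ i, a i ^ 2 - η * (∑ i, |a i|) ^ 2 ≤ ∑ i, ∑ j, a i * a j * e i j := by
  classical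
  have h : ∀ i j, (if i = j then a i ^ 2 else 0) - η * (|a i| * |a j|) ≤ a i * a j * e i j := by
    intro i j
    rcases eq_or_ne i j with rfl | hij
    · simp only [if_true, h1, mul_one]
      have : 0 ≤ η * (|a i| * |a i|) := by positivity
      nlinarith
    · simp only [hij, if_false, zero_sub]
      have h2 : |a i * a j * e i j| ≤ η * (|a i| * |a j|) := by
        rw [abs_mul, abs_mul, abs_of_nonneg (h0 i j), mul_comm η]
        exact mul_le_mul_of_nonneg_left (hη i j hij) (by positivity)
      linarith [neg_abs_le (a i * a j * e i j)]
  calc _ = ∑ i, ∑ j, ((if i = j then a i ^ 2 else 0) - η * (|a i| * |a j|)) := by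
        simp only [Finset.sum_sub_distrib, Finset.sum_ite_eq, Finset.mem_univ, if_true]
        rw [sq (∑ i, |a i|), Finset.sum_mul_sum, Finset.mul_sum]
        simp_rw [Finset.mul_sum]
    _ ≤ _ := Finset.sum_le_sum fun i _ => Finset.sum_le_sum fun j _ => h i j

/-- The coefficients of a combination of well separated Gaussians are bounded by its `L²` norm. -/
lemma sq_sum_abs_le_integral_bumpSum_sq {d : ℕ} {ι : Type*} [Fintype ι] {b ρ : ℝ} (hb : 0 < b)
    {p : ι → EuclideanSpace ℝ (Fin d)} (hρ : 0 ≤ ρ) (hp : ∀ i j, i ≠ j → ρ ≤ ‖p i - p j‖)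
    (hη : Real.exp (-(b / 2) * ρ ^ 2) ≤ 1 / (2 * (Fintype.card ι + 1))) (a : ι → ℝ) :
    (Real.pi / (2 * b)) ^ ((d : ℝ) / 2) * (∑ i, |a i|) ^ 2 ≤
      2 * (Fintype.card ι + 1) * ∫ x, bumpSum b p a x ^ 2 := by
  rw [integral_bumpSum_sq hb]
  have h := sum_sq_sub_le_sum_mul a (fun i j => Real.exp (-(b / 2) * ‖p i - p j‖ ^ 2))
    (η := Real.exp (-(b / 2) * ρ ^ 2)) (by simp) (fun i j => (Real.exp_pos _).le)
    (fun i j hij => by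
      rw [Real.exp_le_exp]
      have := pow_le_pow_left₀ hρ (hp i j hij) 2
      nlinarith) (Real.exp_pos _).le
  set Q := ∑ i, ∑ j, a i * a j * Real.exp (-(b / 2) * ‖p i - p j‖ ^ 2)
  set η := Real.exp (-(b / 2) * ρ ^ 2)
  set A := ∑ i, |a i|
  have hcs : A ^ 2 ≤ (Fintype.card ι + 1 : ℝ) * ∑ i, a i ^ 2 := by
    have h1 := sq_sum_le_card_mul_sum_sq (s := Finset.univ) (f := fun i => |a i|)
    simp only [sq_abs, Finset.card_univ] at h1
    have h2 : 0 ≤ ∑ i, a i ^ 2 := Finset.sum_nonneg fun i _ => sq_nonneg _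
    linarith
  have hk : (0 : ℝ) < Fintype.card ι + 1 := by positivity
  set k : ℝ := Fintype.card ι + 1
  rw [le_div_iff₀ (by positivity)] at hη
  -- Cauchy–Schwarz gives 2k ∑ aᵢ² ≥ 2A², and the off-diagonal part costs at most 2kηA² ≤ A².
  have : A ^ 2 ≤ 2 * k * Q := by
    have h3 : η * (2 * k) * A ^ 2 ≤ 1 * A ^ 2 := by gcongr
    have h4 : 2 * k * (∑ i, a i ^ 2 - η * A ^ 2) ≤ 2 * k * Q := by gcongr
    nlinarith
  calc _ ≤ (Real.pi / (2 * b)) ^ ((d : ℝ) / 2) * (2 * k * Q) := by gcongr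
    _ = _ := by ring

/-- The coefficients of a combination of well separated Gaussians are bounded by its values at
the centres. -/
lemma sum_abs_le_sum_abs_bumpSum {d : ℕ} {ι : Type*} [Fintype ι] {b ρ : ℝ} (hb : 0 < b)
    {p : ι → EuclideanSpace ℝ (Fin d)} (hρ : 0 ≤ ρ) (hp : ∀ i j, i ≠ j → ρ ≤ ‖p i - p j‖)
    (hη : Real.exp (-(b / 2) * ρ ^ 2) ≤ 1 / (2 * (Fintype.card ι + 1))) (a : ι → ℝ) :
    ∑ i, |a i| ≤ 2 * ∑ i, |bumpSum b p a (p i)| := by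
  classical
  set η := Real.exp (-(b / 2) * ρ ^ 2)
  set A := ∑ i, |a i| with hA
  have hA0 : 0 ≤ A := Finset.sum_nonneg fun i _ => abs_nonneg _
  have h : ∀ i, |a i| ≤ |bumpSum b p a (p i)| + η * A := by
    intro i
    have h1 : bumpSum b p a (p i) = a i + ∑ j ∈ Finset.univ.erase i, a j * bump b (p j) (p i) := by
      rw [bumpSum, ← Finset.add_sum_erase _ _ (Finset.mem_univ i), bump_self, mul_one]
    have h2 : |∑ j ∈ Finset.univ.erase i, a j * bump b (p j) (p i)| ≤ η * A := by
      rw [hA, Finset.mul_sum]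
      refine (Finset.abs_sum_le_sum_abs _ _).trans ((Finset.sum_le_sum fun j hj => ?_).trans
        (Finset.sum_le_univ_sum_of_nonneg fun j => by positivity))
      rw [abs_mul, abs_of_pos bump_pos, mul_comm]
      refine mul_le_mul_of_nonneg_right ?_ (abs_nonneg _)
      rw [bump, Real.exp_le_exp]
      have := pow_le_pow_left₀ hρ (hp i j (Finset.ne_of_mem_erase hj).symm) 2
      nlinarith [sq_nonneg ‖p i - p j‖]
    have h3 : a i = bumpSum b p a (p i) - ∑ j ∈ Finset.univ.erase i, a j * bump b (p j) (p i) := by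
      rw [h1]; ring
    calc |a i| = |bumpSum b p a (p i) - ∑ j ∈ Finset.univ.erase i, a j * bump b (p j) (p i)| := by
          rw [← h3]
      _ ≤ _ := (abs_sub _ _).trans (by gcongr)
  have h4 : A ≤ ∑ i, |bumpSum b p a (p i)| + Fintype.card ι * (η * A) := by
    refine (Finset.sum_le_sum fun i _ => h i).trans_eq ?_
    rw [Finset.sum_add_distrib]
    simp
  rw [le_div_iff₀ (by positivity)] at hη
  have h5 : η * (2 * (Fintype.card ι + 1)) * A ≤ 1 * A := by gcongr
  have h6 : 0 ≤ η * A := by positivity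
  nlinarith

end

/-! ### Spans of Gaussians and coefficient control at a fixed width -/

section Span

variable {d : ℕ} {b : ℝ} {ι : Type*} [Fintype ι]

lemma mem_span_range_bump {p : ι → EuclideanSpace ℝ (Fin d)}
    {v : EuclideanSpace ℝ (Fin d) → ℝ}
    (hv : v ∈ Submodule.span ℝ (range fun i => bump b (p i))) : ∃ a, v = bumpSum b p a := by
  obtain ⟨a, ha⟩ := (Submodule.mem_span_range_iff_exists_fun ℝ).1 hv
  refine ⟨a, ?_⟩
  rw [← ha]
  ext x
  simp [bumpSum]

/-- The normalising constant is taken as a unit so that it can be cancelled in both inclusions of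
spans. -/
lemma gaussianRBF_eq_smul_bump {σ : ℝ} (hσ : 0 < σ) (p : EuclideanSpace ℝ (Fin d)) :
    ∃ K : ℝˣ, gaussianRBF p ((σ ^ 2) • (1 : Matrix (Fin d) (Fin d) ℝ)) =
      K • bump (1 / (2 * σ ^ 2)) p := by
  have hdet : 0 < ((σ ^ 2) • (1 : Matrix (Fin d) (Fin d) ℝ)).det := by
    rw [Matrix.det_smul, Matrix.det_one]
    positivity
  refine ⟨Units.mk0 ((2 * Real.pi) ^ (-(d : ℝ) / 2) *
    ((σ ^ 2) • (1 : Matrix (Fin d) (Fin d) ℝ)).det ^ (-(1 : ℝ) / 2)) (by positivity), ?_⟩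
  have hinv : ((σ ^ 2) • (1 : Matrix (Fin d) (Fin d) ℝ))⁻¹ = (σ ^ 2)⁻¹ • 1 := by
    refine Matrix.inv_eq_right_inv ?_
    rw [Matrix.smul_mul, Matrix.mul_smul, smul_smul, mul_inv_cancel₀ (by positivity), one_smul,
      Matrix.one_mul]
  ext x
  rw [gaussianRBF, hinv, Pi.smul_apply, Units.smul_def, Units.val_mk0, smul_eq_mul, bump,
    EuclideanSpace.norm_sq_eq]
  congr 2
  rw [Matrix.smul_mulVec, Matrix.one_mulVec, dotProduct_smul, dotProduct, smul_eq_mul]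
  simp only [Real.norm_eq_abs, sq_abs, ← sq]
  field_simp

lemma grbfSpace_eq_span_bump {n : ℕ} {σ : ℝ} (hσ : 0 < σ)
    (m : Fin n → EuclideanSpace ℝ (Fin d)) :
    grbfSpace m σ = Submodule.span ℝ (range fun i => bump (1 / (2 * σ ^ 2)) (m i)) := by
  choose K hK using fun i => gaussianRBF_eq_smul_bump hσ (m i)
  refine le_antisymm (Submodule.span_le.2 ?_) (Submodule.span_le.2 ?_)
  · rintro _ ⟨i, rfl⟩
    simp only [hK i]
    exact Submodule.smul_mem _ ((K i : ℝˣ) : ℝ) (Submodule.subset_span ⟨i, rfl⟩)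
  · rintro _ ⟨i, rfl⟩
    have h : bump (1 / (2 * σ ^ 2)) (m i) =
        (((K i)⁻¹ : ℝˣ) : ℝ) • gaussianRBF (m i) ((σ ^ 2) • (1 : Matrix (Fin d) (Fin d) ℝ)) := by
      rw [hK i, ← Units.smul_def, inv_smul_smul]
    simp only [h]
    exact Submodule.smul_mem _ _ (Submodule.subset_span ⟨i, rfl⟩)

end Span

/-- Only the L² part of the Sobolev norm is needed, so the chosen weak gradient never has to be
identified. -/
lemma sqrt_integral_sq_le_h1Norm {d : ℕ} (v : EuclideanSpace ℝ (Fin d) → ℝ) :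
    √(∫ x, v x ^ 2) ≤ h1Norm univ v := by
  rw [h1Norm, setIntegral_univ]
  exact Real.sqrt_le_sqrt (le_add_of_nonneg_right (integral_nonneg fun x => by positivity))

lemma norm_toLp_two_eq_sqrt_integral_sq {α : Type*} [MeasurableSpace α] {μ : Measure α}
    {v : α → ℝ} (hv : MemLp v 2 μ) : ‖hv.toLp v‖ = √(∫ x, v x ^ 2 ∂μ) := by
  have h : ‖hv.toLp v‖ ^ 2 = ∫ x, v x ^ 2 ∂μ := by
    rw [← real_inner_self_eq_norm_sq, L2.inner_def]
    refine integral_congr_ae ?_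
    filter_upwards [hv.coeFn_toLp] with x hx
    rw [hx]
    simp [sq]
  rw [← h, Real.sqrt_sq (norm_nonneg _)]

/-- Functions in the span of finitely many Gaussians are combinations of some of these Gaussians
with coefficients controlled by the `L²` norm. -/
lemma exists_bumpSum_sum_abs_le {d n : ℕ} {b : ℝ} (hb : 0 < b)
    (m : Fin n → EuclideanSpace ℝ (Fin d)) :
    ∃ (κ : Type) (_ : Fintype κ) (g : κ → Fin n) (C : ℝ), 0 ≤ C ∧
      ∀ v ∈ Submodule.span ℝ (range fun i => bump b (m i)),
        ∃ a, v = bumpSum b (m ∘ g) a ∧ ∑ i, |a i| ≤ C * √(∫ x, v x ^ 2) := by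
  -- Means may coincide, so an independent subfamily with the same span is selected.
  obtain ⟨κ, g, hg, hspan, hli⟩ := exists_linearIndependent' ℝ fun i => bump b (m i)
  have : Fintype κ := Fintype.ofInjective g hg
  let T : (κ → ℝ) →ₗ[ℝ] Lp ℝ 2 (volume : Measure (EuclideanSpace ℝ (Fin d))) :=
    { toFun := fun a => (memLp_bumpSum hb (m ∘ g) a).toLp
      map_add' := fun a a' => by
        rw [← MemLp.toLp_add]
        congr 1
        ext x
        simp [bumpSum, add_mul, Finset.sum_add_distrib]
      map_smul' := fun r a => by
        rw [RingHom.id_apply, ← MemLp.toLp_const_smul]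
        congr 1
        ext x
        simp [bumpSum, mul_assoc, Finset.mul_sum] }
  have hker : LinearMap.ker T = ⊥ := by
    rw [LinearMap.ker_eq_bot']
    intro a ha
    have h1 : (memLp_bumpSum hb (m ∘ g) a).toLp =
      (MemLp.zero' : MemLp (fun _ => (0 : ℝ)) 2 volume).toLp := ha
    rw [MemLp.toLp_eq_toLp_iff, (continuous_bumpSum b _ a).ae_eq_iff_eq volume
      continuous_const] at h1
    have h2 := Fintype.linearIndependent_iff.1 hli a (by
      refine Eq.trans ?_ h1
      ext x
      simp [bumpSum])
    exact funext h2
  -- An injective linear map on a finite-dimensional space is bounded below; `K` depends on `b` in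
  -- an uncontrolled way.
  obtain ⟨K, -, hK⟩ := T.exists_antilipschitzWith hker
  refine ⟨κ, this, g, Fintype.card κ * K, by positivity, fun v hv => ?_⟩
  rw [← hspan] at hv
  obtain ⟨a, rfl⟩ := mem_span_range_bump (p := m ∘ g) hv
  refine ⟨a, rfl, ?_⟩
  have h3 : ‖a‖ ≤ K * ‖T a‖ := by
    have := hK.le_mul_dist a 0
    simpa using this
  rw [show T a = (memLp_bumpSum hb (m ∘ g) a).toLp from rfl,
    norm_toLp_two_eq_sqrt_integral_sq] at h3
  calc ∑ i, |a i| ≤ ∑ _i : κ, ‖a‖ := Finset.sum_le_sum fun i _ => norm_le_pi_norm a i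
    _ = Fintype.card κ * ‖a‖ := by simp
    _ ≤ Fintype.card κ * (K * √(∫ x, bumpSum b (m ∘ g) a x ^ 2)) := by gcongr
    _ = _ := by ring

/-! ### Exponential smallness of the complement terms -/

section Complement

variable {d : ℕ} {ι κ : Type*} [Fintype ι] [Fintype κ] {Ω : Set (EuclideanSpace ℝ (Fin d))}
  {b δ : ℝ} {p : ι → EuclideanSpace ℝ (Fin d)} {q : κ → EuclideanSpace ℝ (Fin d)}

lemma bump_half_le_of_notMem (hb : 0 ≤ b) (hδ : 0 ≤ δ) {p x : EuclideanSpace ℝ (Fin d)}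
    (hp : Metric.ball p δ ⊆ Ω) (hx : x ∈ Ωᶜ) :
    bump (b / 2) p x ≤ Real.exp (-(b / 4) * δ ^ 2) * bump (b / 4) p x := by
  have h : δ ≤ ‖x - p‖ := by
    by_contra! h
    exact hx (hp (by rwa [mem_ball_iff_norm]))
  have := bump_le_of_le_dist (b := b / 4) (by positivity) hδ h
  rwa [show 2 * (b / 4) = b / 2 by ring] at this

lemma setIntegral_bump_le (hb : 0 < b) (p : EuclideanSpace ℝ (Fin d))
    (s : Set (EuclideanSpace ℝ (Fin d))) :
    ∫ x in s, bump (b / 4) p x ≤ (Real.pi / (b / 4)) ^ ((d : ℝ) / 2) := by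
  rw [← integral_bump (by positivity) p]
  exact setIntegral_le_integral (integrable_bump (by positivity) p)
    (ae_of_all _ fun x => bump_pos.le)

/-- Decay and integrability both come from the first argument; the gradient of the second is merely
bounded, so the centres `q` may lie anywhere. -/
lemma abs_complementForm_bumpSum_le (hΩ : MeasurableSet Ω) (hb : 0 < b) (hδ : 0 ≤ δ)
    (hp : ∀ i, Metric.ball (p i) δ ⊆ Ω) (w : ι → ℝ) (v : κ → ℝ) :
    |complementForm Ω (bumpSum b p w) (bumpSum b q v)| ≤
      (∑ i, |v i|) * Real.exp (-(b / 4) * δ ^ 2) *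
        ((∑ i, |w i|) * (b + 1) ^ 2 * (Real.pi / (b / 4)) ^ ((d : ℝ) / 2)) := by
  set e := Real.exp (-(b / 4) * δ ^ 2)
  set A := ∑ i, |v i| with hA
  have hA0 : 0 ≤ A := Finset.sum_nonneg fun i _ => abs_nonneg _
  clear_value A
  have hint : ∀ i, Integrable (fun x => (b + 1) ^ 2 * A * e * |w i| * bump (b / 4) (p i) x)
      (volume.restrict Ωᶜ) :=
    fun i => ((integrable_bump (by positivity) (p i)).const_mul _).restrict
  have h : ∀ x ∈ Ωᶜ, ‖inner ℝ (gradient (bumpSum b p w) x) (gradient (bumpSum b q v) x)‖ ≤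
      ∑ i, (b + 1) ^ 2 * A * e * |w i| * bump (b / 4) (p i) x := by
    intro x hx
    have h1 : ‖gradient (bumpSum b q v) x‖ ≤ (b + 1) * A := by
      refine (norm_gradient_bumpSum_le hb.le).trans ?_
      rw [hA, Finset.mul_sum]
      refine Finset.sum_le_sum fun i _ => ?_
      have h2 : bump (b / 2) (q i) x ≤ 1 := bump_le_one (by positivity)
      calc _ ≤ |v i| * ((b + 1) * 1) := by gcongr
        _ = _ := by ring
    have h2 : ‖gradient (bumpSum b p w) x‖ ≤
        ∑ i, |w i| * ((b + 1) * (e * bump (b / 4) (p i) x)) := by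
      refine (norm_gradient_bumpSum_le hb.le).trans (Finset.sum_le_sum fun i _ => ?_)
      have := bump_half_le_of_notMem hb.le hδ (hp i) hx
      gcongr
    refine (norm_inner_le_norm (𝕜 := ℝ) _ _).trans ((mul_le_mul h2 h1 (norm_nonneg _)
      ((norm_nonneg _).trans h2)).trans_eq ?_)
    rw [Finset.sum_mul]
    exact Finset.sum_congr rfl fun i _ => by ring
  rw [complementForm, ← Real.norm_eq_abs]
  refine (norm_integral_le_of_norm_le (integrable_finsetSum _ fun i _ => hint i)
    (ae_restrict_of_forall_mem hΩ.compl h)).trans ?_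
  rw [integral_finsetSum _ fun i _ => hint i, Finset.sum_mul, Finset.sum_mul, Finset.mul_sum]
  refine Finset.sum_le_sum fun i _ => ?_
  rw [integral_const_mul]
  have := setIntegral_bump_le hb (p i) Ωᶜ
  calc _ ≤ (b + 1) ^ 2 * A * e * |w i| * (Real.pi / (b / 4)) ^ ((d : ℝ) / 2) := by gcongr
    _ = _ := by ring

lemma abs_complementLoad_bumpSum_le {E : (EuclideanSpace ℝ (Fin d) → ℝ) →
      EuclideanSpace ℝ (Fin d) → ℝ} {f : EuclideanSpace ℝ (Fin d) → ℝ} (hE : MemLp (E f) 2)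
    (hΩ : MeasurableSet Ω) (hb : 0 < b) (hδ : 0 ≤ δ)
    (hq : ∀ i, Metric.ball (q i) δ ⊆ Ω) (v : κ → ℝ) :
    |complementLoad Ω E f (bumpSum b q v)| ≤
      (∑ i, |v i|) * Real.exp (-(b / 4) * δ ^ 2) *
        ((∫ x, E f x ^ 2) + (Real.pi / (b / 4)) ^ ((d : ℝ) / 2)) := by
  set e := Real.exp (-(b / 4) * δ ^ 2)
  have hEi : Integrable (fun x => E f x ^ 2) := hE.integrable_sq
  have hint : ∀ i, Integrable (fun x => |v i| * e * (E f x ^ 2 + bump (b / 4) (q i) x))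
      (volume.restrict Ωᶜ) :=
    fun i => ((hEi.add (integrable_bump (by positivity) (q i))).const_mul _).restrict
  have h : ∀ x ∈ Ωᶜ, ‖E f x * bumpSum b q v x‖ ≤
      ∑ i, |v i| * e * (E f x ^ 2 + bump (b / 4) (q i) x) := by
    intro x hx
    rw [norm_mul, Real.norm_eq_abs, Real.norm_eq_abs]
    refine (mul_le_mul_of_nonneg_left abs_bumpSum_le (abs_nonneg _)).trans ?_
    rw [Finset.mul_sum]
    refine Finset.sum_le_sum fun i _ => ?_
    set y := bump (b / 4) (q i) x
    have hy0 : 0 < y := bump_pos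
    have hy1 : y ≤ 1 := bump_le_one (by positivity)
    have h1 : bump b (q i) x ≤ e * y := by
      refine le_trans ?_ (bump_half_le_of_notMem hb.le hδ (hq i) hx)
      have h2 : bump b (q i) x = bump (b / 2) (q i) x * bump (b / 2) (q i) x := by
        rw [bump_mul_same]; congr 1; ring
      rw [h2]
      exact mul_le_of_le_one_left bump_pos.le (bump_le_one (by positivity))
    -- Young's inequality together with y² ≤ y.
    have h3 : |E f x| * y ≤ E f x ^ 2 + y := by
      rw [← sq_abs (E f x)]
      nlinarith [sq_nonneg (|E f x| - y), abs_nonneg (E f x)]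
    calc |E f x| * (|v i| * bump b (q i) x) ≤ |E f x| * (|v i| * (e * y)) := by gcongr
      _ = |v i| * e * (|E f x| * y) := by ring
      _ ≤ _ := by gcongr
  rw [complementLoad, ← Real.norm_eq_abs]
  refine (norm_integral_le_of_norm_le (integrable_finsetSum _ fun i _ => hint i)
    (ae_restrict_of_forall_mem hΩ.compl h)).trans ?_
  rw [integral_finsetSum _ fun i _ => hint i, Finset.sum_mul, Finset.sum_mul]
  refine Finset.sum_le_sum fun i _ => ?_
  rw [integral_const_mul, integral_add hEi.restrict (integrable_bump (by positivity) _).restrict]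
  have h4 := setIntegral_bump_le hb (q i) Ωᶜ
  have h5 : ∫ x in Ωᶜ, E f x ^ 2 ≤ ∫ x, E f x ^ 2 :=
    setIntegral_le_integral hEi (ae_of_all _ fun x => sq_nonneg _)
  gcongr

lemma consistencyQuotient_bumpSum_le {E : (EuclideanSpace ℝ (Fin d) → ℝ) →
      EuclideanSpace ℝ (Fin d) → ℝ} {f : EuclideanSpace ℝ (Fin d) → ℝ} (hE : MemLp (E f) 2)
    (hΩ : MeasurableSet Ω) (hb : 0 < b) (hδ : 0 ≤ δ)
    (hp : ∀ i, Metric.ball (p i) δ ⊆ Ω) (hq : ∀ i, Metric.ball (q i) δ ⊆ Ω)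
    (w : ι → ℝ) {v : κ → ℝ} {C : ℝ} (hC : 0 ≤ C)
    (hv : ∑ i, |v i| ≤ C * √(∫ x, bumpSum b q v x ^ 2)) :
    consistencyQuotient Ω E f (bumpSum b p w) (bumpSum b q v) ≤
      C * (Real.exp (-(b / 4) * δ ^ 2) *
        (((∑ i, |w i|) * (b + 1) ^ 2 + 1) * (Real.pi / (b / 4)) ^ ((d : ℝ) / 2) +
          ∫ x, E f x ^ 2)) := by
  have h1 := abs_complementForm_bumpSum_le (q := q) hΩ hb hδ hp w v
  have h2 := abs_complementLoad_bumpSum_le hE hΩ hb hδ hq v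
  have h3 : ∑ i, |v i| ≤ C * h1Norm univ (bumpSum b q v) :=
    hv.trans (mul_le_mul_of_nonneg_left (sqrt_integral_sq_le_h1Norm _) hC)
  have hB : 0 ≤ ∑ i, |w i| := Finset.sum_nonneg fun i _ => abs_nonneg _
  have hD : 0 ≤ ∫ x, E f x ^ 2 := integral_nonneg fun x => sq_nonneg _
  set X := Real.exp (-(b / 4) * δ ^ 2) *
        (((∑ i, |w i|) * (b + 1) ^ 2 + 1) * (Real.pi / (b / 4)) ^ ((d : ℝ) / 2) +
          ∫ x, E f x ^ 2) with hX
  have hX0 : 0 ≤ X := by positivity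
  -- This needs no positive norm: a zero denominator gives quotient zero.
  refine div_le_of_le_mul₀ (Real.sqrt_nonneg _) (by positivity) ?_
  calc _ ≤ _ := (abs_sub _ _).trans (add_le_add h1 h2)
    _ = (∑ i, |v i|) * X := by rw [hX]; ring
    _ ≤ C * h1Norm univ (bumpSum b q v) * X := by gcongr
    _ = _ := by ring

end Complement

/-! ### Powers of b against exponentials -/

section Asymptotics

/-- Deliberately crude: an integer power is easier to handle, and the exponential absorbs the loss.
-/
lemma one_div_pow_le_rpow {b : ℝ} (hb : 1 ≤ b) (d : ℕ) :
    1 / b ^ d ≤ (Real.pi / (2 * b)) ^ ((d : ℝ) / 2) := by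
  have hb0 : 0 < b := by linarith
  have h1 : 1 / b ≤ Real.pi / (2 * b) := by
    rw [div_le_div_iff₀ hb0 (by positivity)]
    nlinarith [Real.two_le_pi]
  calc 1 / b ^ d = (1 / b) ^ (d : ℝ) := by rw [Real.rpow_natCast, one_div_pow]
    _ ≤ (1 / b) ^ ((d : ℝ) / 2) :=
        Real.rpow_le_rpow_of_exponent_ge (by positivity) ((div_le_one hb0).2 hb)
          (by linarith [Nat.cast_nonneg (α := ℝ) d])
    _ ≤ _ := Real.rpow_le_rpow (by positivity) h1 (by positivity)

lemma sum_abs_le_pow_mul_sqrt_integral {d : ℕ} {ι : Type*} [Fintype ι] {b ρ : ℝ} (hb : 1 ≤ b)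
    {p : ι → EuclideanSpace ℝ (Fin d)} (hρ : 0 ≤ ρ) (hp : ∀ i j, i ≠ j → ρ ≤ ‖p i - p j‖)
    (hη : Real.exp (-(b / 2) * ρ ^ 2) ≤ 1 / (2 * (Fintype.card ι + 1))) (a : ι → ℝ) :
    ∑ i, |a i| ≤ 2 * (Fintype.card ι + 1) * b ^ d * √(∫ x, bumpSum b p a x ^ 2) := by
  have hb0 : 0 < b := by linarith
  have h1 := sq_sum_abs_le_integral_bumpSum_sq hb0 hρ hp hη a
  set I := ∫ x, bumpSum b p a x ^ 2
  have hI : 0 ≤ I := integral_nonneg fun x => sq_nonneg _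
  set A := ∑ i, |a i|
  set k : ℝ := 2 * (Fintype.card ι + 1)
  have hk : 1 ≤ k := by
    have : (0 : ℝ) ≤ Fintype.card ι := by positivity
    linarith
  have hbd : 1 ≤ b ^ d := one_le_pow₀ hb
  have h2 : A ^ 2 ≤ k * b ^ d * I := by
    have h3 : 1 / b ^ d * A ^ 2 ≤ k * I :=
      (mul_le_mul_of_nonneg_right (one_div_pow_le_rpow hb d) (sq_nonneg A)).trans h1
    rw [one_div, inv_mul_le_iff₀ (by positivity)] at h3
    linarith
  have h4 : 1 ≤ k * b ^ d := one_le_mul_of_one_le_of_one_le hk hbd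
  refine le_of_sq_le_sq ?_ (by positivity)
  rw [mul_pow, Real.sq_sqrt hI]
  exact h2.trans (mul_le_mul_of_nonneg_right (by nlinarith) hI)

lemma tendsto_one_div_two_mul_sq :
    Tendsto (fun σ : ℝ => 1 / (2 * σ ^ 2)) (𝓝[>] 0) atTop := by
  have h : Tendsto (fun σ : ℝ => (2 : ℝ)⁻¹ * (σ⁻¹) ^ 2) (𝓝[>] 0) atTop :=
    ((tendsto_pow_atTop two_ne_zero).comp tendsto_inv_nhdsGT_zero).const_mul_atTop (by norm_num)
  refine h.congr fun σ => ?_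
  rw [one_div, mul_inv, inv_pow]

lemma eventually_exp_neg_mul_le {c ε : ℝ} (hc : 0 < c) (hε : 0 < ε) :
    ∀ᶠ b : ℝ in atTop, Real.exp (-(b / 2) * c) ≤ ε := by
  have h : Tendsto (fun b : ℝ => -((c / 2) * b)) atTop atBot :=
    tendsto_neg_atTop_atBot.comp (tendsto_id.const_mul_atTop (by positivity))
  filter_upwards [(Real.tendsto_exp_atBot.comp h).eventually (ge_mem_nhds hε)] with b hb
  refine le_trans (le_of_eq ?_) hb
  simp only [Function.comp]
  ring_nf

lemma eventually_pow_mul_exp_neg_le_one {c : ℝ} (hc : 0 < c) (n : ℕ) :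
    ∀ᶠ b : ℝ in atTop, b ^ n * Real.exp (-c * b) ≤ 1 := by
  have h := tendsto_rpow_mul_exp_neg_mul_atTop_nhds_zero (n : ℝ) c hc
  filter_upwards [h.eventually (ge_mem_nhds one_pos)] with b hb
  rwa [Real.rpow_natCast] at hb

end Asymptotics

/-! ### Separation of the means and distance to the complement -/

section Geometry

variable {d : ℕ} {ι : Type*} [Finite ι] {p : ι → EuclideanSpace ℝ (Fin d)}

lemma exists_pos_le_norm_sub (hp : Function.Injective p) :
    ∃ ρ > 0, ∀ i j, i ≠ j → ρ ≤ ‖p i - p j‖ := by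
  have h : ∀ᶠ ρ : ℝ in 𝓝[>] 0, ∀ i j, i ≠ j → ρ ≤ ‖p i - p j‖ := by
    refine eventually_all.2 fun i => eventually_all.2 fun j => ?_
    by_cases hij : i = j
    · simp [hij]
    · have : 0 < ‖p i - p j‖ := norm_pos_iff.2 (sub_ne_zero.2 (hp.ne hij))
      filter_upwards [nhdsWithin_le_nhds (ge_mem_nhds this)] with ρ hρ _ using hρ
  obtain ⟨ρ, h1, h2⟩ := (h.and self_mem_nhdsWithin).exists
  exact ⟨ρ, h2, h1⟩

lemma exists_pos_ball_subset {Ω : Set (EuclideanSpace ℝ (Fin d))} (hΩ : IsOpen Ω)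
    (hp : ∀ i, p i ∈ Ω) : ∃ δ > 0, ∀ i, Metric.ball (p i) δ ⊆ Ω := by
  have h : ∀ᶠ δ : ℝ in 𝓝[>] 0, ∀ i, Metric.ball (p i) δ ⊆ Ω := by
    refine eventually_all.2 fun i => ?_
    obtain ⟨ε, hε, hεΩ⟩ := Metric.isOpen_iff.1 hΩ (p i) (hp i)
    filter_upwards [nhdsWithin_le_nhds (ge_mem_nhds hε)] with δ hδ
    exact (Metric.ball_subset_ball hδ).trans hεΩ
  obtain ⟨δ, h1, h2⟩ := (h.and self_mem_nhdsWithin).exists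
  exact ⟨δ, h2, h1⟩

end Geometry

/-! ### Assembly of the consistency estimate -/

section Consistency

variable {d n : ℕ} {Ω : Set (EuclideanSpace ℝ (Fin d))}
  {m : Fin n → EuclideanSpace ℝ (Fin d)}
  {E : (EuclideanSpace ℝ (Fin d) → ℝ) → EuclideanSpace ℝ (Fin d) → ℝ}
  {f : EuclideanSpace ℝ (Fin d) → ℝ} {δ : ℝ}

lemma bddAbove_consistencyQuotient (hE : MemLp (E f) 2) (hΩ : MeasurableSet Ω) (hδ : 0 ≤ δ)
    (hm : ∀ i, Metric.ball (m i) δ ⊆ Ω) {σ : ℝ} (hσ : 0 < σ)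
    {w : EuclideanSpace ℝ (Fin d) → ℝ} (hw : w ∈ grbfSpace m σ) :
    BddAbove (range fun v : grbfSpace m σ => consistencyQuotient Ω E f w v) := by
  have hb : 0 < 1 / (2 * σ ^ 2) := by positivity
  obtain ⟨κ, _, g, C, hC, h⟩ := exists_bumpSum_sum_abs_le hb m
  rw [← grbfSpace_eq_span_bump hσ] at h
  obtain ⟨a, rfl, -⟩ := h w hw
  refine ⟨C * (Real.exp (-(1 / (2 * σ ^ 2) / 4) * δ ^ 2) *
    (((∑ i, |a i|) * (1 / (2 * σ ^ 2) + 1) ^ 2 + 1) *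
      (Real.pi / (1 / (2 * σ ^ 2) / 4)) ^ ((d : ℝ) / 2) + ∫ x, E f x ^ 2)), ?_⟩
  rintro _ ⟨⟨v, hv⟩, rfl⟩
  obtain ⟨a', rfl, ha'⟩ := h v hv
  exact consistencyQuotient_bumpSum_le hE hΩ hb hδ (fun i => hm (g i)) (fun i => hm (g i)) a hC ha'

lemma consistencyQuotient_nonneg (w v : EuclideanSpace ℝ (Fin d) → ℝ) :
    0 ≤ consistencyQuotient Ω E f w v :=
  div_nonneg (abs_nonneg _) (Real.sqrt_nonneg _)

lemma consistencyError_nonneg (σ : ℝ) (w : EuclideanSpace ℝ (Fin d) → ℝ) :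
    0 ≤ consistencyError Ω m σ E f w :=
  Real.iSup_nonneg fun v => consistencyQuotient_nonneg w v

/-- Indexing by the set of means removes repetitions, so that distinct indices have separated
centres. -/
lemma grbfSpace_eq_span_bump_range {σ : ℝ} (hσ : 0 < σ) :
    grbfSpace m σ =
      Submodule.span ℝ
        (range fun p : range m => bump (1 / (2 * σ ^ 2)) (p : EuclideanSpace ℝ (Fin d))) := by
  rw [grbfSpace_eq_span_bump hσ]
  congr 1
  ext v
  simp

/-- A family of combinations of Gaussians that is controlled polynomially in `σ⁻¹`, either at the
centres or in norm, has polynomially bounded coefficients. -/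
lemma exists_eventually_sum_abs_le [Fintype (range m)]
    {w : ℝ → EuclideanSpace ℝ (Fin d) → ℝ} {u : EuclideanSpace ℝ (Fin d) → ℝ}
    (h : (∀ σ : ℝ, 0 < σ → ∀ i, w σ (m i) = u (m i)) ∨
      ∃ q : ℕ, (fun σ : ℝ => h1Norm univ (w σ)) =O[𝓝[>] 0] fun σ : ℝ => (σ ^ q)⁻¹)
    {ρ : ℝ} (hρ : 0 ≤ ρ)
    (hp : ∀ i j : range m, i ≠ j → ρ ≤ ‖(i : EuclideanSpace ℝ (Fin d)) - j‖)
    (hη : ∀ᶠ σ : ℝ in 𝓝[>] 0,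
      Real.exp (-(1 / (2 * σ ^ 2) / 2) * ρ ^ 2) ≤ 1 / (2 * (Fintype.card (range m) + 1))) :
    ∃ (M : ℝ) (N : ℕ), 0 ≤ M ∧ ∀ᶠ σ : ℝ in 𝓝[>] 0, ∀ a : range m → ℝ,
      w σ = bumpSum (1 / (2 * σ ^ 2)) (fun p : range m => (p : EuclideanSpace ℝ (Fin d))) a →
        ∑ i, |a i| ≤ M * (1 / (2 * σ ^ 2)) ^ N := by
  rcases h with h | ⟨q, h⟩
  · refine ⟨2 * ∑ p : range m, |u p|, 0, by positivity, ?_⟩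
    filter_upwards [hη, self_mem_nhdsWithin] with σ h1 (hσ : 0 < σ) a ha
    have h2 := sum_abs_le_sum_abs_bumpSum (by positivity) hρ hp h1 a
    rw [← ha] at h2
    rw [pow_zero, mul_one]
    refine h2.trans_eq ?_
    congr 1
    refine Finset.sum_congr rfl ?_
    rintro ⟨_, i, rfl⟩ -
    rw [h σ hσ i]
  · obtain ⟨K, hK0, hK⟩ := h.exists_nonneg
    rw [Asymptotics.isBigOWith_iff] at hK
    refine ⟨2 * (Fintype.card (range m) + 1) * (K * 2 ^ q), d + q, by positivity, ?_⟩
    filter_upwards [hη, self_mem_nhdsWithin, hK, tendsto_one_div_two_mul_sq.eventually_ge_atTop 1,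
      nhdsWithin_le_nhds (ge_mem_nhds one_pos)] with σ h1 (hσ : 0 < σ) h2 h3 h4 a ha
    have h5 := sum_abs_le_pow_mul_sqrt_integral h3 hρ hp h1 a
    rw [← ha] at h5
    set b := 1 / (2 * σ ^ 2) with hb
    have hb0 : 0 < b := by positivity
    have h0 : 0 ≤ h1Norm univ (w σ) := Real.sqrt_nonneg _
    rw [Real.norm_of_nonneg h0, Real.norm_of_nonneg (by positivity)] at h2
    -- For σ ≤ 1, σ⁻¹ ≤ σ⁻² = 2b.
    have h6 : (σ ^ q)⁻¹ ≤ (2 * b) ^ q := by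
      have : 2 * b = (σ ^ 2)⁻¹ := by rw [hb]; field_simp
      rw [this, inv_pow]
      gcongr
      exact pow_le_of_le_one hσ.le h4 two_ne_zero
    calc _ ≤ _ := h5
      _ ≤ 2 * (Fintype.card (range m) + 1) * b ^ d * (K * (2 * b) ^ q) := by
        gcongr
        exact (sqrt_integral_sq_le_h1Norm _).trans (h2.trans (by gcongr))
      _ = _ := by rw [mul_pow, pow_add]; ring

lemma consistencyError_isBigO_exp (hE : MemLp (E f) 2) (hΩ : MeasurableSet Ω) (hδ : 0 < δ)
    (hm : ∀ i, Metric.ball (m i) δ ⊆ Ω)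
    {w : ℝ → EuclideanSpace ℝ (Fin d) → ℝ} {u : EuclideanSpace ℝ (Fin d) → ℝ}
    (hw : ∀ σ : ℝ, 0 < σ → w σ ∈ grbfSpace m σ)
    (h : (∀ σ : ℝ, 0 < σ → ∀ i, w σ (m i) = u (m i)) ∨
      ∃ q : ℕ, (fun σ : ℝ => h1Norm univ (w σ)) =O[𝓝[>] 0] fun σ : ℝ => (σ ^ q)⁻¹) :
    (fun σ : ℝ => consistencyError Ω m σ E f (w σ)) =O[𝓝[>] 0]
      fun σ : ℝ => Real.exp (-(δ ^ 2 / 8) / (2 * σ ^ 2)) := by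
  classical
  have : Fintype (range m) := Fintype.ofFinite _
  obtain ⟨ρ, hρ, hp⟩ := exists_pos_le_norm_sub
    (Subtype.val_injective : Function.Injective fun p : range m => (p : EuclideanSpace ℝ (Fin d)))
  have hη := tendsto_one_div_two_mul_sq.eventually (eventually_exp_neg_mul_le (c := ρ ^ 2)
    (by positivity) (ε := 1 / (2 * (Fintype.card (range m) + 1))) (by positivity))
  obtain ⟨M, N, hM, hMN⟩ := exists_eventually_sum_abs_le h hρ.le hp hη
  have hball : ∀ p : range m, Metric.ball (p : EuclideanSpace ℝ (Fin d)) δ ⊆ Ω := by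
    rintro ⟨_, i, rfl⟩
    exact hm i
  have hD : 0 ≤ ∫ x, E f x ^ 2 := integral_nonneg fun x => sq_nonneg _
  set k : ℝ := 2 * (Fintype.card (range m) + 1)
  -- The Gaussian integral at b = 1, which dominates those for b ≥ 1.
  set G : ℝ := (Real.pi / (1 / 4)) ^ ((d : ℝ) / 2)
  set D := ∫ x, E f x ^ 2
  set L := k * ((4 * M + 1) * G + D)
  have hL : 0 ≤ L := by positivity
  refine Asymptotics.IsBigO.of_bound L ?_
  filter_upwards [hη, self_mem_nhdsWithin, hMN, tendsto_one_div_two_mul_sq.eventually_ge_atTop 1,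
    -- The exponent collects `d` from the coefficients of `v`, `N` from those of `w σ`, and 2 from
    -- the two gradients.
    tendsto_one_div_two_mul_sq.eventually
      (eventually_pow_mul_exp_neg_le_one (c := δ ^ 2 / 8) (by positivity) (d + (N + 2)))]
    with σ h1 (hσ : 0 < σ) h2 h3 h4
  have hspan := grbfSpace_eq_span_bump_range (m := m) hσ
  have hexp : Real.exp (-(δ ^ 2 / 8) / (2 * σ ^ 2)) =
      Real.exp (-(δ ^ 2 / 8) * (1 / (2 * σ ^ 2))) := by
    congr 1; ring
  rw [hexp, Real.norm_of_nonneg (consistencyError_nonneg σ _),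
    Real.norm_of_nonneg (Real.exp_pos _).le]
  have hwσ := hw σ hσ
  rw [hspan] at hwσ
  obtain ⟨a, ha⟩ := mem_span_range_bump hwσ
  have hB := h2 a ha
  refine Real.iSup_le ?_ (by positivity)
  rintro ⟨v, hv⟩
  rw [hspan] at hv
  obtain ⟨a', rfl⟩ := mem_span_range_bump hv
  set b := 1 / (2 * σ ^ 2)
  have hb0 : 0 < b := by linarith
  have h5 := sum_abs_le_pow_mul_sqrt_integral h3 hρ.le hp h1 a'
  have h6 := consistencyQuotient_bumpSum_le hE hΩ hb0 hδ.le hball hball a (by positivity) h5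
  rw [ha]
  refine h6.trans ?_
  have hG : (Real.pi / (b / 4)) ^ ((d : ℝ) / 2) ≤ G := by
    refine Real.rpow_le_rpow (by positivity) ?_ (by positivity)
    gcongr
  have hpow : 1 ≤ b ^ (N + 2) := one_le_pow₀ h3
  have h7 : (∑ i, |a i|) * (b + 1) ^ 2 + 1 ≤ (4 * M + 1) * b ^ (N + 2) := by
    calc _ ≤ M * b ^ N * (b + b) ^ 2 + b ^ (N + 2) := by gcongr
      _ = _ := by ring
  have h8 : ((∑ i, |a i|) * (b + 1) ^ 2 + 1) * (Real.pi / (b / 4)) ^ ((d : ℝ) / 2) + D ≤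
      ((4 * M + 1) * G + D) * b ^ (N + 2) := by
    calc _ ≤ (4 * M + 1) * b ^ (N + 2) * G + D * b ^ (N + 2) :=
          add_le_add (mul_le_mul h7 hG (by positivity) (by positivity))
            (le_mul_of_one_le_right hD hpow)
      _ = _ := by ring
  -- One half absorbs the powers of `b`, the other is the claimed rate.
  have h9 : Real.exp (-(b / 4) * δ ^ 2) =
      Real.exp (-(δ ^ 2 / 8) * b) * Real.exp (-(δ ^ 2 / 8) * b) := by
    rw [← Real.exp_add]; ring_nf
  calc _ ≤ k * b ^ d * (Real.exp (-(b / 4) * δ ^ 2) *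
        (((4 * M + 1) * G + D) * b ^ (N + 2))) := by gcongr
    _ = L * (b ^ (d + (N + 2)) * Real.exp (-(δ ^ 2 / 8) * b)) * Real.exp (-(δ ^ 2 / 8) * b) := by
      rw [h9, pow_add b d]; ring
    _ ≤ L * 1 * Real.exp (-(δ ^ 2 / 8) * b) := by gcongr
    _ = _ := by ring

end Consistency

theorem mainTheorem3 (d n : ℕ) (Ω : Set (EuclideanSpace ℝ (Fin d)))
    (hΩ : IsOpen Ω) (hΩb : Bornology.IsBounded Ω)
    (m : Fin n → EuclideanSpace ℝ (Fin d)) (hm : ∀ i, m i ∈ Ω) :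
    ∃ c : ℝ, 0 < c ∧
      ∀ (E : (EuclideanSpace ℝ (Fin d) → ℝ) → EuclideanSpace ℝ (Fin d) → ℝ)
        (π : ℝ → (EuclideanSpace ℝ (Fin d) → ℝ) → EuclideanSpace ℝ (Fin d) → ℝ)
        (f u : EuclideanSpace ℝ (Fin d) → ℝ),
        IsExtensionOperator Ω E →
        (∀ σ : ℝ, 0 < σ → ∀ w, MemH1 Ω w → π σ w ∈ grbfSpace m σ) →
        MemH1 Ω f → MemH1 Ω u →
        -- either `π` interpolates the continuous function `u` at the means, or
        -- the norms of the representatives of `u` grow at most polynomially in `σ⁻¹`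
        ((ContinuousOn u Ω ∧ ∀ σ : ℝ, 0 < σ → ∀ i, π σ u (m i) = u (m i)) ∨
          ∃ q : ℕ, (fun σ : ℝ => h1Norm univ (π σ u)) =O[𝓝[>] 0] fun σ : ℝ => (σ ^ q)⁻¹) →
        (∀ σ : ℝ, 0 < σ → BddAbove
          (range fun v : grbfSpace m σ => consistencyQuotient Ω E f (π σ u) v)) ∧
        ((fun σ : ℝ => consistencyError Ω m σ E f (π σ u)) =O[𝓝[>] 0]
          fun σ : ℝ => (σ ^ (d + 4))⁻¹ * Real.exp (-c / (2 * σ ^ 2))) ∧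
        (∀ c' : ℝ, c' < c / 2 →
          (fun σ : ℝ => consistencyError Ω m σ E f (π σ u)) =O[𝓝[>] 0]
            fun σ : ℝ => Real.exp (-c' / σ ^ 2)) := by
  obtain ⟨δ, hδ, hball⟩ := exists_pos_ball_subset hΩ hm
  -- `δ` was chosen from `Ω` and `m` alone, before `E`, `f`, `u` and `π`.
  refine ⟨δ ^ 2 / 8, by positivity, fun E π f u hE hπ hf hu h => ?_⟩
  obtain ⟨-, hEf, -, -⟩ := hE.memH1 f hf
  rw [Measure.restrict_univ] at hEf
  have hO := consistencyError_isBigO_exp hEf hΩ.measurableSet hδ hball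
    (fun σ hσ => hπ σ hσ u hu) (h.imp_left And.right)
  refine ⟨fun σ hσ => bddAbove_consistencyQuotient hEf hΩ.measurableSet hδ.le hball hσ
    (hπ σ hσ u hu), hO.trans (Asymptotics.IsBigO.of_bound 1 ?_),
    fun c' hc' => hO.trans (Asymptotics.IsBigO.of_bound 1 ?_)⟩
  -- The bound `hO` has no power of σ; the prefactor is at least 1 for σ ≤ 1.
  · filter_upwards [self_mem_nhdsWithin, nhdsWithin_le_nhds (ge_mem_nhds one_pos)]
      with σ (hσ : 0 < σ) hσ1
    rw [one_mul, norm_mul]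
    refine le_mul_of_one_le_left (norm_nonneg _) ?_
    rw [Real.norm_of_nonneg (by positivity)]
    exact (one_le_inv₀ (by positivity)).2 (pow_le_one₀ hσ.le hσ1)
  · filter_upwards [self_mem_nhdsWithin] with σ (hσ : 0 < σ)
    rw [one_mul, Real.norm_of_nonneg (Real.exp_pos _).le, Real.norm_of_nonneg (Real.exp_pos _).le,
      Real.exp_le_exp, ← div_div]
    gcongr
    linarith
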